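/- Let $R$ be a commutative unital ring that is indecomposable, i.e. whose only idempotents are $0$ and $1$. Let $\mathscr{A}$ be a non-empty set, $\mathscr{A}^*$ the set of finite words over $\mathscr{A}$ and $\omega$ the empty word. Let $\mathsf{X}\subseteq\mathscr{A}^{\mathbb{N}}$ be a subshift, i.e. for some $F\subseteq\mathscr{A}^*$, $\mathsf{X}$ is the set of all sequences in which no word of $F$ occurs, and let $\mathcal{L}_{\mathsf{X}}\subseteq\mathscr{A}^*$ be the set of finite words that occur in some sequence of $\mathsf{X}$. For $\alpha,\beta\in\mathcal{L}_{\mathsf{X}}$ put $C(\alpha,\beta)=\{\beta x\in\mathsf{X}:\alpha x\in\mathsf{X}\}$, and let $\mathcal{U}$ be the Boolean algebra of subsets of $\mathsf{X}$ generated by all $C(\alpha,\beta)$ (under finite unions, finite intersections and complements in $\mathsf{X}$). Let $\widetilde{\mathcal{A}}_R(\mathsf{X})$ be the universal unital $R$-algebra with generators $\{p_A:A\in\mathcal{U}\}$ and $\{s_a,s_a^*:a\in\mathscr{A}\}$ subject to the relations (i) $p_{\mathsf{X}}=1$, $p_{\emptyset}=0$, $p_{A\cap B}=p_Ap_B$ and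 $p_{A\cup B}=p_A+p_B-p_{A\cap B}$ for all $A,B\in\mathcal{U}$; (ii) $s_as_a^*s_a=s_a$ and $s_a^*s_as_a^*=s_a^*$ for all $a\in\mathscr{A}$; (iii) $s_\beta s_\alpha^*s_\alpha s_\beta^*=p_{C(\alpha,\beta)}$ for all $\alpha,\beta\in\mathcal{L}_{\mathsf{X}}$, where $s_\omega=s_\omega^*=1$ and, for $\alpha=\alpha_1\cdots\alpha_n$, $s_\alpha=s_{\alpha_1}\cdots s_{\alpha_n}$ and $s_\alpha^*=s_{\alpha_n}^*\cdots s_{\alpha_1}^*$. Let $\widehat{\mathcal{U}}$ be the Stone dual of $\mathcal{U}$, i.e. the set of its ultrafilters (maximal proper filters) with the topology generated by the sets $O_A=\{\xi\in\widehat{\mathcal{U}}:A\in\xi\}$, $A\in\mathcal{U}$, and let $\operatorname{Lc}(\widehat{\mathcal{U}},R)$ be the $R$-algebra of compactly supported locally constant functions $\widehat{\mathcal{U}}\to R$ with pointwise operations. Then $$\operatorname{span}_R\{s_\alpha p_As_\alpha^*:A\in\mathcal{U},\ \alpha\in\mathcal{L}_{\mathsf{X}}\}=\operatorname{span}_R\{p_A:A\in\mathcal{U}\},$$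 this submodule is a (unital) subalgebra of $\widetilde{\mathcal{A}}_R(\mathsf{X})$ (the diagonal subalgebra), and it is isomorphic, as an $R$-algebra, to $\operatorname{Lc}(\widehat{\mathcal{U}},R)$. -/

import Mathlib

namespace SubshiftAlg

universe u v

/-! ### Words and subshifts over an arbitrary alphabet -/

section Symbolic

variable {𝒜 : Type u}

/-- The word `x i, x (i + 1), …, x (i + n - 1)` of length `n` occurring in the sequence `x`
at position `i`. -/
def block (x : ℕ → 𝒜) (i n : ℕ) : List 𝒜 := List.ofFn fun k : Fin n => x (i + k)

/-- The subshift given by a set `F` of forbidden words: all sequences in which no word of `F`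
occurs. -/
def subshiftOf (F : Set (List 𝒜)) : Set (ℕ → 𝒜) := {x | ∀ i n, block x i n ∉ F}

/-- A subshift is a set of sequences given by some set of forbidden words. -/
def IsSubshift (X : Set (ℕ → 𝒜)) : Prop := ∃ F : Set (List 𝒜), X = subshiftOf F

/-- The language of `X`: all finite words `x 0, …, x (n - 1)` with `x ∈ X`. -/
def language (X : Set (ℕ → 𝒜)) : Set (List 𝒜) := {w | ∃ x ∈ X, ∃ n, w = block x 0 n}

/-- The concatenation `w x` of a finite word and a sequence. -/
def concat (w : List 𝒜) (x : ℕ → 𝒜) : ℕ → 𝒜 :=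
  fun n => if h : n < w.length then w[n] else x (n - w.length)

/-- The set `C(α, β) = {β x ∈ X : α x ∈ X}`, as a set of points of `X`. -/
def C (X : Set (ℕ → 𝒜)) (α β : List 𝒜) : Set X :=
  {y | ∃ x : ℕ → 𝒜, (y : ℕ → 𝒜) = concat β x ∧ concat α x ∈ X}

/-- The Boolean algebra `𝒰` of subsets of `X` generated by all `C(α, β)` with `α`, `β` in the
language of `X`. -/
def U (X : Set (ℕ → 𝒜)) : BooleanSubalgebra (Set X) :=
  BooleanSubalgebra.closure {S | ∃ α ∈ language X, ∃ β ∈ language X, S = C X α β}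

/-- `C(α, β)` as an element of `𝒰`. -/
def CU (X : Set (ℕ → 𝒜)) {α β : List 𝒜} (hα : α ∈ language X) (hβ : β ∈ language X) : U X :=
  ⟨C X α β, BooleanSubalgebra.subset_closure ⟨α, hα, β, hβ, rfl⟩⟩

end Symbolic

/-! ### The unital subshift algebra -/

section Algebra

variable {𝒜 : Type u} (R : Type v) [CommRing R] (X : Set (ℕ → 𝒜))

/-- The generators `p_A` (`A ∈ 𝒰`), `s_a` and `s_a^*` (`a` a letter) of the unital subshift
algebra. -/
inductive Gen : Type u
  | p (A : U X) : Gen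
  | s (a : 𝒜) : Gen
  | sStar (a : 𝒜) : Gen

/-- The generator `p_A` in the free algebra. -/
def fp (A : U X) : FreeAlgebra R (Gen X) := FreeAlgebra.ι R (Gen.p A)

/-- `s_α = s_{α₁} ⋯ s_{αₙ}` in the free algebra (`1` for the empty word). -/
def fs (α : List 𝒜) : FreeAlgebra R (Gen X) :=
  (α.map fun a => FreeAlgebra.ι R (Gen.s a)).prod

/-- `s_α^* = s_{αₙ}^* ⋯ s_{α₁}^*` in the free algebra (`1` for the empty word). -/
def fsStar (α : List 𝒜) : FreeAlgebra R (Gen X) :=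
  (α.reverse.map fun a => FreeAlgebra.ι R (Gen.sStar a)).prod

/-- The defining relations of the unital subshift algebra. -/
inductive Rel : FreeAlgebra R (Gen X) → FreeAlgebra R (Gen X) → Prop
  | p_top : Rel (fp R X ⊤) 1
  | p_inter (A B : U X) : Rel (fp R X (A ⊓ B)) (fp R X A * fp R X B)
  | p_union (A B : U X) : Rel (fp R X (A ⊔ B)) (fp R X A + fp R X B - fp R X (A ⊓ B))
  | p_empty : Rel (fp R X ⊥) 0
  | s_sStar_s (a : 𝒜) : Rel (fs R X [a] * fsStar R X [a] * fs R X [a]) (fs R X [a])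
  | sStar_s_sStar (a : 𝒜) :
      Rel (fsStar R X [a] * fs R X [a] * fsStar R X [a]) (fsStar R X [a])
  | p_C (α β : List 𝒜) (hα : α ∈ language X) (hβ : β ∈ language X) :
      Rel (fs R X β * fsStar R X α * fs R X α * fsStar R X β) (fp R X (CU X hα hβ))

/-- The unital subshift algebra of `X` over `R`: the universal unital `R`-algebra on the
generators `p_A`, `s_a`, `s_a^*` subject to the relations `Rel`. -/
abbrev UnitalSubshiftAlgebra : Type (max u v) := RingQuot (Rel R X)

/-- The element `p_A` of the unital subshift algebra. -/
def p (A : U X) : UnitalSubshiftAlgebra R X := RingQuot.mkAlgHom R (Rel R X) (fp R X A)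

/-- The element `s_α` of the unital subshift algebra. -/
def s (α : List 𝒜) : UnitalSubshiftAlgebra R X := RingQuot.mkAlgHom R (Rel R X) (fs R X α)

/-- The element `s_α^*` of the unital subshift algebra. -/
def sStar (α : List 𝒜) : UnitalSubshiftAlgebra R X :=
  RingQuot.mkAlgHom R (Rel R X) (fsStar R X α)

/-- The `R`-linear span of all `s_α p_A s_α^*` with `A ∈ 𝒰` and `α` in the language of `X`. -/
def diagonalSpan : Submodule R (UnitalSubshiftAlgebra R X) :=
  Submodule.span R {t | ∃ A : U X, ∃ α ∈ language X, t = s R X α * p R X A * sStar R X α}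

/-- The `R`-linear span of all `p_A` with `A ∈ 𝒰`. -/
def projectionSpan : Submodule R (UnitalSubshiftAlgebra R X) :=
  Submodule.span R (Set.range (p R X))

end Algebra

/-! ### The Stone dual of a Boolean algebra -/

section Stone

/-- The Stone dual: the set of ultrafilters, i.e. of maximal proper filters, of `B`. -/
def StoneDual (B : Type u) [BooleanAlgebra B] : Type u :=
  {ξ : Order.PFilter B // Maximal (fun η : Order.PFilter B => (η : Set B) ≠ Set.univ) ξ}

variable {B : Type u} [BooleanAlgebra B]

/-- The set `O_A` of all ultrafilters containing `A`. -/
def basicOpen (A : B) : Set (StoneDual B) := {ξ | A ∈ ξ.1}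

/-- The topology of the Stone dual is generated by the sets `O_A`. -/
instance : TopologicalSpace (StoneDual B) :=
  TopologicalSpace.generateFrom (Set.range basicOpen)

end Stone

/-- `Lc(Y, R)`: the `R`-algebra of compactly supported locally constant functions `Y → R` with
pointwise operations. -/
def Lc (Y : Type u) [TopologicalSpace Y] (R : Type v) [CommRing R] :
    NonUnitalSubalgebra R (Y → R) where
  carrier := {f | IsLocallyConstant f ∧ HasCompactSupport f}
  zero_mem' := ⟨IsLocallyConstant.const 0, HasCompactSupport.zero⟩
  add_mem' hf hg := ⟨hf.1.add hg.1, hf.2.add hg.2⟩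
  mul_mem' hf hg := ⟨hf.1.mul hg.1, hf.2.mul_right⟩
  smul_mem' r _ hf := ⟨hf.1.comp (r • ·), hf.2.comp_left (g := (r • ·)) (smul_zero r)⟩

end SubshiftAlg

namespace SubshiftAlg

/-! ### Families of projections indexed by a Boolean algebra -/

section Projections

variable {R B S T : Type*} [CommRing R] [BooleanAlgebra B] [Ring S] [Algebra R S]
  [Ring T] [Algebra R T]

/-! The projections `p_A` and the indicators of the sets `O_A` are two projection families on the
same Boolean algebra. Each extends to formal combinations of its elements, with image the span of
the family. On a cell `c` (below `a` or `aᶜ` for each `a` in the support of `f`) the extension of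
`f` acts as a scalar depending only on `f` and `c`. If `r • q a = 0` forces `r = 0` or `a = ⊥`, the
kernel is therefore independent of the family (`ker_lift_le`), and the two images are isomorphic.

Faithfulness of `p` comes from letting the algebra act on functions `X → R`, where `p_A` becomes
multiplication by the indicator of `A` (`representation`); for indicators on the Stone dual it comes
from ultrafilters of points. Compactness of the dual shows that the indicators span `Lc`
(`mem_span_basicIndicator`).

Finally, the elements `s_α p_A s_α^*` add nothing to the span of the `p_A`: this is Boolean
induction on `A` (`s_mul_p_mul_sStar_mem`). -/

theorem exists_injective_algHom_of_ker_eq {A : Type*} [Ring A] [Algebra R A] {f : A →ₐ[R] S}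
    (hf : Function.Surjective f) {g : A →ₐ[R] T} (hfg : ∀ x, f x = 0 ↔ g x = 0) :
    ∃ φ : S →ₐ[R] T, Function.Injective φ ∧ ∀ x, φ (f x) = g x := by
  have hinv (y) : f (Function.surjInv hf y) = y := Function.surjInv_eq hf y
  have hg {x x'} (h : f x = f x') : g x = g x' := by
    rw [← sub_eq_zero, ← map_sub, ← hfg, map_sub, h, sub_self]
  let φ : S →ₐ[R] T := AlgHom.ofLinearMap
    { toFun := fun y => g (Function.surjInv hf y)
      map_add' := fun y z => by rw [← map_add]; exact hg (by simp only [map_add, hinv])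
      map_smul' := fun r y => by
        rw [RingHom.id_apply, ← map_smul]
        exact hg (by simp only [map_smul, hinv]) }
    ((hg (by rw [hinv, map_one])).trans (map_one g))
    fun y z => (hg (by simp only [map_mul, hinv])).trans (map_mul g _ _)
  refine ⟨φ, ?_, fun x => hg (hinv _)⟩
  rw [injective_iff_map_eq_zero]
  intro y hy
  rw [← hinv y]
  exact (hfg _).2 hy

/-- A family of projections indexed by a Boolean algebra, compatible with the Boolean
operations. -/
structure IsProjectionFamily (q : B → S) : Prop where
  map_top : q ⊤ = 1
  map_bot : q ⊥ = 0
  map_inf : ∀ a b, q (a ⊓ b) = q a * q b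
  map_sup : ∀ a b, q (a ⊔ b) = q a + q b - q (a ⊓ b)

namespace IsProjectionFamily

variable {q : B → S} {q' : B → T}

theorem map_compl (h : IsProjectionFamily q) (a : B) : q aᶜ = 1 - q a := by
  have h1 := h.map_sup a aᶜ
  rw [sup_compl_eq_top, inf_compl_eq_bot, h.map_top, h.map_bot, sub_zero] at h1
  rw [h1, add_sub_cancel_left]

theorem commute (h : IsProjectionFamily q) (a b : B) : q a * q b = q b * q a := by
  rw [← h.map_inf, inf_comm, h.map_inf]

/-- The multiplicative map underlying a family of projections. -/
def toMonoidHom (h : IsProjectionFamily q) : AsBoolRing B →* S where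
  toFun a := q (ofBoolRing a)
  map_one' := by rw [ofBoolRing_one, h.map_top]
  map_mul' a b := by rw [ofBoolRing_mul, h.map_inf]

/-- The extension of a family of projections to formal linear combinations. -/
noncomputable def lift (R : Type*) [CommRing R] [Algebra R S] (h : IsProjectionFamily q) :
    MonoidAlgebra R (AsBoolRing B) →ₐ[R] S :=
  MonoidAlgebra.lift R S (AsBoolRing B) h.toMonoidHom

theorem lift_apply (h : IsProjectionFamily q) (f : MonoidAlgebra R (AsBoolRing B)) :
    h.lift R f = f.coeff.sum fun a r => r • q (ofBoolRing a) :=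
  MonoidAlgebra.lift_apply _ _

theorem toSubmodule_range_lift (h : IsProjectionFamily q) :
    Subalgebra.toSubmodule (h.lift R).range = Submodule.span R (Set.range q) := by
  apply le_antisymm
  · rintro _ ⟨f, rfl⟩
    change h.lift R f ∈ _
    rw [lift_apply]
    exact Submodule.sum_mem _ fun a _ => Submodule.smul_mem _ _ (Submodule.subset_span ⟨_, rfl⟩)
  · rw [Submodule.span_le]
    rintro _ ⟨a, rfl⟩
    refine ⟨MonoidAlgebra.single (toBoolRing a) 1, ?_⟩
    change MonoidAlgebra.lift R S (AsBoolRing B) h.toMonoidHom _ = _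
    rw [MonoidAlgebra.lift_single, one_smul]
    rfl

/-- Each `b ∈ F` splits `q e` as `q (e ⊓ b) + q (e ⊓ bᶜ)`. Induction on `F` thus reduces vanishing
to cells without listing atoms. -/
theorem mul_eq_zero_of_cells (h : IsProjectionFamily q) (t : S) (F : Finset B) (e : B)
    (H : ∀ c ≤ e, (∀ b ∈ F, c ≤ b ∨ c ≤ bᶜ) → q c * t = 0) : q e * t = 0 := by
  classical
  induction F using Finset.induction_on generalizing e with
  | empty => exact H e le_rfl (by simp)
  | insert b F _ ih =>
    have h1 : q (e ⊓ b) * t = 0 := ih _ fun c hc hF => H c (hc.trans inf_le_left) fun b' hb' => by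
      rcases Finset.mem_insert.1 hb' with rfl | hb'
      exacts [.inl (hc.trans inf_le_right), hF _ hb']
    have h2 : q (e ⊓ bᶜ) * t = 0 := ih _ fun c hc hF => H c (hc.trans inf_le_left) fun b' hb' => by
      rcases Finset.mem_insert.1 hb' with rfl | hb'
      exacts [.inr (hc.trans inf_le_right), hF _ hb']
    rw [h.map_inf] at h1 h2
    rw [h.map_compl, mul_sub, mul_one, sub_mul, h1, sub_zero] at h2
    exact h2

open Classical in
theorem mul_lift_of_cell (h : IsProjectionFamily q) (f : MonoidAlgebra R (AsBoolRing B)) (c : B)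
    (hc : ∀ a ∈ f.coeff.support, c ≤ ofBoolRing a ∨ c ≤ (ofBoolRing a)ᶜ) :
    q c * h.lift R f =
      (∑ a ∈ f.coeff.support, if c ≤ ofBoolRing a then f.coeff a else 0) • q c := by
  rw [lift_apply, Finsupp.sum, Finset.mul_sum, Finset.sum_smul]
  refine Finset.sum_congr rfl fun a ha => ?_
  rw [mul_smul_comm, ← h.map_inf]
  split_ifs with hle
  · rw [inf_eq_left.2 hle]
  · have : c ⊓ ofBoolRing a = ⊥ := (le_compl_iff_disjoint_right.1 ((hc a ha).resolve_left hle)).eq_bot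
    rw [this, h.map_bot, smul_zero, zero_smul]

/-- The scalar on a cell is the same for `q` and `q'`. Faithfulness of `q` makes it zero unless the
cell is `⊥`, so only `q` needs to be faithful. -/
theorem ker_lift_le (h : IsProjectionFamily q) (h' : IsProjectionFamily q')
    (hq : ∀ (r : R) (a : B), r • q a = 0 → r = 0 ∨ a = ⊥) {f : MonoidAlgebra R (AsBoolRing B)}
    (hf : h.lift R f = 0) : h'.lift R f = 0 := by
  classical
  rw [← one_mul (h'.lift R f), ← h'.map_top]
  refine h'.mul_eq_zero_of_cells _ (f.coeff.support.image ofBoolRing) _ fun c _ hc => ?_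
  have hc' : ∀ a ∈ f.coeff.support, c ≤ ofBoolRing a ∨ c ≤ (ofBoolRing a)ᶜ := fun a ha =>
    hc _ (Finset.mem_image_of_mem _ ha)
  have key := h.mul_lift_of_cell f c hc'
  rw [hf, mul_zero] at key
  rw [h'.mul_lift_of_cell f c hc']
  rcases hq _ _ key.symm with h0 | h0
  · rw [h0, zero_smul]
  · rw [h0, h'.map_bot, smul_zero]

/-- Two faithful families of projections span isomorphic algebras. -/
theorem exists_algHom_range_lift (h : IsProjectionFamily q) (h' : IsProjectionFamily q')
    (hq : ∀ (r : R) (a : B), r • q a = 0 → r = 0 ∨ a = ⊥)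
    (hq' : ∀ (r : R) (a : B), r • q' a = 0 → r = 0 ∨ a = ⊥) :
    ∃ φ : (h.lift R).range →ₐ[R] T,
      Function.Injective φ ∧ Set.range φ = (h'.lift R).range := by
  have hs := (h.lift R).rangeRestrict_surjective
  obtain ⟨φ, hφ, key⟩ := exists_injective_algHom_of_ker_eq hs (g := h'.lift R) fun f =>
    ⟨fun hf => h.ker_lift_le h' hq (congrArg Subtype.val hf),
      fun hf => Subtype.ext (h'.ker_lift_le h hq' hf)⟩
  refine ⟨φ, hφ, ?_⟩
  ext t
  constructor
  · rintro ⟨x, rfl⟩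
    obtain ⟨f, rfl⟩ := hs x
    exact ⟨f, (key f).symm⟩
  · rintro ⟨f, rfl⟩
    exact ⟨_, key f⟩

end IsProjectionFamily

end Projections

/-! ### Locally constant functions on the Stone dual -/

section StoneDual

universe u

variable {B : Type u} [BooleanAlgebra B]

theorem pfilter_eq_univ_iff (F : Order.PFilter B) : (F : Set B) = Set.univ ↔ ⊥ ∈ F := by
  refine ⟨fun h => ?_, fun h => Set.eq_univ_of_forall fun a => F.mem_of_le bot_le h⟩
  rw [← SetLike.mem_coe, h]
  trivial

namespace StoneDual

theorem bot_notMem (ξ : StoneDual B) : ⊥ ∉ ξ.1 := fun h =>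
  ξ.2.prop ((pfilter_eq_univ_iff _).2 h)

/-- If `a ∉ ξ`, the filter generated by `ξ` and `a` is improper by maximality, so some `c ∈ ξ` is
disjoint from `a`, that is, `c ≤ aᶜ`. -/
theorem compl_mem_iff (ξ : StoneDual B) (a : B) : aᶜ ∈ ξ.1 ↔ a ∉ ξ.1 := by
  refine ⟨fun h h' => ξ.bot_notMem ?_, fun ha => ?_⟩
  · rw [← inf_compl_eq_bot (a := a)]
    exact Order.PFilter.inf_mem h' h
  · have hG : Order.IsPFilter {b : B | ∃ c ∈ ξ.1, c ⊓ a ≤ b} := by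
      refine Order.IsPFilter.of_def ⟨⊤, ⊤, Order.PFilter.top_mem, le_top⟩ ?_ ?_
      · rintro b ⟨c, hc, hb⟩ b' ⟨c', hc', hb'⟩
        refine ⟨b ⊓ b', ⟨c ⊓ c', Order.PFilter.inf_mem hc hc', le_inf ?_ ?_⟩,
          inf_le_left, inf_le_right⟩
        · exact (inf_le_inf_right _ inf_le_left).trans hb
        · exact (inf_le_inf_right _ inf_le_right).trans hb'
      · rintro x y hxy ⟨c, hc, hx⟩
        exact ⟨c, hc, hx.trans hxy⟩
    have hmem (b : B) : b ∈ hG.toPFilter ↔ ∃ c ∈ ξ.1, c ⊓ a ≤ b := Iff.rfl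
    have hle : ξ.1 ≤ hG.toPFilter := fun c hc => ⟨c, hc, inf_le_left⟩
    by_cases hbot : ⊥ ∈ hG.toPFilter
    · obtain ⟨c, hc, h⟩ := (hmem _).1 hbot
      exact Order.PFilter.mem_of_le (le_compl_iff_disjoint_right.2 (disjoint_iff_inf_le.2 h)) hc
    · exact absurd (ξ.2.le_of_ge (mt (pfilter_eq_univ_iff _).1 hbot) hle
        ((hmem a).2 ⟨⊤, Order.PFilter.top_mem, inf_le_right⟩)) ha

/-- A subset of a Boolean algebra closed under meets, upwards closed, and containing exactly one
of `a` and `aᶜ` for every `a`, is an ultrafilter. -/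
theorem exists_of_prime (F : Set B) (htop : ⊤ ∈ F) (hinf : ∀ a ∈ F, ∀ b ∈ F, a ⊓ b ∈ F)
    (hle : ∀ a b, a ≤ b → a ∈ F → b ∈ F) (hcompl : ∀ a, aᶜ ∈ F ↔ a ∉ F) :
    ∃ ξ : StoneDual B, ∀ a, a ∈ ξ.1 ↔ a ∈ F := by
  have hF : Order.IsPFilter F := Order.IsPFilter.of_def ⟨⊤, htop⟩
    (fun a ha b hb => ⟨a ⊓ b, hinf a ha b hb, inf_le_left, inf_le_right⟩) (hle _ _)
  refine ⟨⟨hF.toPFilter, ?_, fun G hG hFG a ha => ?_⟩, fun a => Iff.rfl⟩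
  · change ¬ _ = _
    rw [pfilter_eq_univ_iff]
    intro h
    exact (hcompl ⊤).1 (by rw [compl_top]; exact h) htop
  · change a ∈ F
    by_contra haF
    refine hG ((pfilter_eq_univ_iff _).2 ?_)
    rw [← inf_compl_eq_bot (a := a)]
    exact Order.PFilter.inf_mem ha (hFG ((hcompl a).2 haF))

end StoneDual

@[simp] theorem mem_basicOpen {a : B} {ξ : StoneDual B} : ξ ∈ basicOpen a ↔ a ∈ ξ.1 := Iff.rfl

theorem basicOpen_top : basicOpen (⊤ : B) = Set.univ :=
  Set.eq_univ_of_forall fun _ => Order.PFilter.top_mem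

theorem basicOpen_bot : basicOpen (⊥ : B) = ∅ :=
  Set.eq_empty_of_forall_notMem fun ξ => ξ.bot_notMem

theorem basicOpen_inf (a b : B) : basicOpen (a ⊓ b) = basicOpen a ∩ basicOpen b :=
  Set.ext fun _ => Order.PFilter.inf_mem_iff

theorem basicOpen_compl (a : B) : basicOpen aᶜ = (basicOpen a)ᶜ :=
  Set.ext fun ξ => ξ.compl_mem_iff a

theorem basicOpen_sup (a b : B) : basicOpen (a ⊔ b) = basicOpen a ∪ basicOpen b := by
  rw [← compl_compl (a ⊔ b), compl_sup, basicOpen_compl, basicOpen_inf, basicOpen_compl,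
    basicOpen_compl, Set.compl_inter, compl_compl, compl_compl]

theorem isTopologicalBasis_basicOpen :
    TopologicalSpace.IsTopologicalBasis (Set.range (basicOpen (B := B))) where
  exists_subset_inter := by
    rintro _ ⟨a, rfl⟩ _ ⟨b, rfl⟩ ξ hξ
    exact ⟨_, ⟨a ⊓ b, rfl⟩, by rwa [basicOpen_inf], by rw [basicOpen_inf]⟩
  sUnion_eq := Set.eq_univ_of_forall fun ξ => ⟨_, ⟨⊤, rfl⟩, Order.PFilter.top_mem⟩
  eq_generateFrom := rfl

theorem isClopen_basicOpen (a : B) : IsClopen (basicOpen a) := by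
  refine ⟨⟨?_⟩, isTopologicalBasis_basicOpen.isOpen ⟨a, rfl⟩⟩
  rw [← basicOpen_compl]
  exact isTopologicalBasis_basicOpen.isOpen ⟨_, rfl⟩

/-- An ultrafilter `𝓕` on the space converges to the point consisting of all `a` with `O_a ∈ 𝓕`. -/
instance : CompactSpace (StoneDual B) where
  isCompact_univ := by
    rw [isCompact_iff_ultrafilter_le_nhds]
    intro 𝓕 _
    obtain ⟨ξ, hξ⟩ := StoneDual.exists_of_prime {a : B | basicOpen a ∈ 𝓕}
      (by
        change basicOpen ⊤ ∈ 𝓕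
        rw [basicOpen_top]
        exact Filter.univ_mem)
      (fun a ha b hb => by
        change basicOpen (a ⊓ b) ∈ 𝓕
        rw [basicOpen_inf]
        exact Filter.inter_mem ha hb)
      (fun a b hab ha => Filter.mem_of_superset ha fun ξ => Order.PFilter.mem_of_le hab)
      (fun a => by
        change basicOpen aᶜ ∈ 𝓕 ↔ _
        rw [basicOpen_compl]
        exact Ultrafilter.compl_mem_iff_notMem)
    refine ⟨ξ, trivial, ?_⟩
    rw [isTopologicalBasis_basicOpen.nhds_hasBasis.ge_iff]
    rintro _ ⟨⟨a, rfl⟩, ha⟩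
    exact (hξ a).1 ha

variable (R : Type*) [CommRing R]

/-- The characteristic function of the set `O_a`. -/
noncomputable def basicIndicator (a : B) : StoneDual B → R := (basicOpen a).indicator 1

variable (B) in
theorem isProjectionFamily_basicIndicator :
    IsProjectionFamily (basicIndicator R : B → StoneDual B → R) where
  map_top := by rw [basicIndicator, basicOpen_top, Set.indicator_univ]
  map_bot := by rw [basicIndicator, basicOpen_bot, Set.indicator_empty]; rfl
  map_inf a b := by
    rw [basicIndicator, basicOpen_inf, Set.inter_indicator_one]
    rfl
  map_sup a b := by
    rw [eq_sub_iff_add_eq]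
    simp only [basicIndicator, basicOpen_sup, basicOpen_inf]
    exact Set.indicator_union_add_inter _ _ _

variable {R}

theorem basicIndicator_mem_Lc (a : B) : basicIndicator R a ∈ Lc (StoneDual B) R :=
  ⟨by
    rw [basicIndicator, ← LocallyConstant.coe_charFn R (isClopen_basicOpen a)]
    exact LocallyConstant.isLocallyConstant _, HasCompactSupport.of_compactSpace _⟩

/-- Near each point `f` agrees with a constant on some `O_a`, so `f` times that indicator lies in
the span. This property passes to finite unions, hence by compactness to the whole space. -/
theorem mem_span_basicIndicator {f : StoneDual B → R} (hf : IsLocallyConstant f) :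
    f ∈ Submodule.span R (Set.range (basicIndicator R : B → StoneDual B → R)) := by
  have hq := isProjectionFamily_basicIndicator B R
  set D := (hq.lift R).range
  have hD : Subalgebra.toSubmodule D = _ := hq.toSubmodule_range_lift
  rw [← hD, Subalgebra.mem_toSubmodule]
  have hmem (a : B) : basicIndicator R a ∈ D := by
    rw [← Subalgebra.mem_toSubmodule, hD]
    exact Submodule.subset_span ⟨a, rfl⟩
  obtain ⟨a, ha, hfa⟩ : ∃ a : B, Set.univ ⊆ basicOpen a ∧ f * basicIndicator R a ∈ D := by
    refine isCompact_univ.induction_on (p := fun K : Set (StoneDual B) =>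
      ∃ a : B, K ⊆ basicOpen a ∧ f * basicIndicator R a ∈ D) ⟨⊥, Set.empty_subset _, ?_⟩ ?_ ?_ ?_
    · rw [hq.map_bot, mul_zero]
      exact zero_mem _
    · rintro s t hst ⟨a, ha, hfa⟩
      exact ⟨a, hst.trans ha, hfa⟩
    · rintro s t ⟨a, ha, hfa⟩ ⟨b, hb, hfb⟩
      refine ⟨a ⊔ b, ?_, ?_⟩
      · rw [basicOpen_sup]
        exact Set.union_subset_union ha hb
      · rw [hq.map_sup, hq.map_inf, mul_sub, mul_add, ← mul_assoc]
        exact sub_mem (add_mem hfa hfb) (mul_mem hfa (hmem b))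
    · intro ξ _
      obtain ⟨_, ⟨⟨a, rfl⟩, ha⟩, hsub⟩ :=
        isTopologicalBasis_basicOpen.nhds_hasBasis.mem_iff.1 ((hf.isOpen_fiber (f ξ)).mem_nhds rfl)
      refine ⟨basicOpen a, mem_nhdsWithin_of_mem_nhds ((isClopen_basicOpen a).isOpen.mem_nhds ha),
        a, subset_rfl, ?_⟩
      have : f * basicIndicator R a = f ξ • basicIndicator R a := by
        funext η
        by_cases hη : η ∈ basicOpen a
        · simp only [Pi.mul_apply, Pi.smul_apply, smul_eq_mul]
          rw [show f η = f ξ from hsub hη]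
        · simp [basicIndicator, hη]
      rw [this]
      exact Subalgebra.smul_mem _ (hmem a) _
  have h1 : basicIndicator R a = 1 := by
    rw [basicIndicator, Set.univ_subset_iff.1 ha, Set.indicator_univ]
  rwa [h1, mul_one] at hfa

variable (B R) in
theorem coe_range_lift_basicIndicator :
    (((isProjectionFamily_basicIndicator B R).lift R).range : Set (StoneDual B → R)) =
      Lc (StoneDual B) R := by
  ext f
  rw [SetLike.mem_coe, ← Subalgebra.mem_toSubmodule,
    (isProjectionFamily_basicIndicator B R).toSubmodule_range_lift]
  refine ⟨fun h => ?_, fun h => mem_span_basicIndicator h.1⟩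
  refine (Submodule.span_le (p := (Lc (StoneDual B) R).toSubmodule)).2 ?_ h
  rintro _ ⟨a, rfl⟩
  exact basicIndicator_mem_Lc a

end StoneDual

/-! ### Words and points of a subshift -/

section Words

variable {𝒜 : Type*} {X : Set (ℕ → 𝒜)}

@[simp] theorem concat_nil (x : ℕ → 𝒜) : concat [] x = x := by
  funext n
  simp [concat]

theorem concat_append (α β : List 𝒜) (x : ℕ → 𝒜) :
    concat (α ++ β) x = concat α (concat β x) := by
  funext n
  simp only [concat, List.length_append, List.getElem_append]
  split_ifs <;> first | rfl | omega | (congr 1; omega)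

theorem concat_apply_add (α : List 𝒜) (x : ℕ → 𝒜) (n : ℕ) : concat α x (n + α.length) = x n := by
  simp [concat]

theorem concat_block (x : ℕ → 𝒜) (n : ℕ) : concat (block x 0 n) (fun k => x (k + n)) = x := by
  funext m
  simp only [concat, block, List.length_ofFn, List.getElem_ofFn, zero_add]
  split_ifs
  · rfl
  · congr 1
    omega

theorem block_concat (α : List 𝒜) (x : ℕ → 𝒜) : block (concat α x) 0 α.length = α := by
  refine List.ext_getElem (by simp [block]) fun n h h' => ?_
  simp [block, concat]

theorem block_concat_add (α : List 𝒜) (x : ℕ → 𝒜) (i n : ℕ) :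
    block (concat α x) (i + α.length) n = block x i n := by
  simp only [block]
  congr 1
  funext k
  rw [add_right_comm, concat_apply_add]

/-- Every word occurring in `x` occurs in `α x`, shifted by the length of `α`. -/
theorem IsSubshift.mem_of_concat_mem (hX : IsSubshift X) {α : List 𝒜} {x : ℕ → 𝒜}
    (h : concat α x ∈ X) : x ∈ X := by
  obtain ⟨F, rfl⟩ := hX
  intro i n
  rw [← block_concat_add α]
  exact h _ _

theorem mem_language_iff {α : List 𝒜} : α ∈ language X ↔ ∃ x, concat α x ∈ X := by
  constructor
  · rintro ⟨x, hx, n, rfl⟩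
    exact ⟨_, (concat_block x n).symm ▸ hx⟩
  · rintro ⟨x, hx⟩
    exact ⟨_, hx, _, (block_concat α x).symm⟩

theorem nil_mem_language (h : X.Nonempty) : [] ∈ language X :=
  mem_language_iff.2 ⟨h.some, by simpa using h.some_mem⟩

theorem mem_language_of_append_left {α β : List 𝒜} (h : α ++ β ∈ language X) :
    α ∈ language X := by
  obtain ⟨x, hx⟩ := mem_language_iff.1 h
  exact mem_language_iff.2 ⟨_, concat_append α β x ▸ hx⟩

theorem IsSubshift.mem_language_of_append_right (hX : IsSubshift X) {α β : List 𝒜}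
    (h : α ++ β ∈ language X) : β ∈ language X := by
  obtain ⟨x, hx⟩ := mem_language_iff.1 h
  rw [concat_append] at hx
  exact mem_language_iff.2 ⟨x, hX.mem_of_concat_mem hx⟩

theorem C_nil_right_inter_C_nil_left {α γ : List 𝒜} (h : α ++ γ ∉ language X) :
    C X α [] ∩ C X [] γ = ∅ := by
  rw [Set.eq_empty_iff_forall_notMem]
  rintro y ⟨⟨x, hyx, hx⟩, ⟨z, hyz, -⟩⟩
  refine h (mem_language_iff.2 ⟨z, ?_⟩)
  rwa [concat_append, ← hyz, hyx, concat_nil]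

end Words

/-! ### The representation on functions on the subshift -/

section Representation

variable {𝒜 : Type*} (R : Type*) [CommRing R] (X : Set (ℕ → 𝒜))

open Classical in
/-- Extension of a function on `X` by zero. -/
noncomputable def extendZero : (X → R) →ₗ[R] (ℕ → 𝒜) → R where
  toFun f x := if h : x ∈ X then f ⟨x, h⟩ else 0
  map_add' f g := by
    funext x
    by_cases h : x ∈ X <;> simp [h]
  map_smul' r f := by
    funext x
    by_cases h : x ∈ X <;> simp [h]

variable {X} in
theorem extendZero_of_mem (f : X → R) {x : ℕ → 𝒜} (h : x ∈ X) :
    extendZero R X f x = f ⟨x, h⟩ := dif_pos h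

variable {X} in
theorem extendZero_of_notMem (f : X → R) {x : ℕ → 𝒜} (h : x ∉ X) : extendZero R X f x = 0 :=
  dif_neg h

/-- The operator `f ↦ (x ↦ f (α x))`. -/
noncomputable def annihilation (α : List 𝒜) : Module.End R (X → R) where
  toFun f x := extendZero R X f (concat α x)
  map_add' f g := by
    rw [map_add]
    rfl
  map_smul' r f := by
    rw [map_smul]
    rfl

open Classical in
/-- The operator sending `f` to the function with value `f x` at `α x`, and zero elsewhere. -/
noncomputable def creation (α : List 𝒜) : Module.End R (X → R) where
  toFun f x := if ∃ y, (x : ℕ → 𝒜) = concat α y then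
    extendZero R X f (fun n => (x : ℕ → 𝒜) (n + α.length)) else 0
  map_add' f g := by
    funext x
    rw [map_add]
    by_cases h : ∃ y, (x : ℕ → 𝒜) = concat α y <;> simp [h]
  map_smul' r f := by
    funext x
    rw [map_smul]
    by_cases h : ∃ y, (x : ℕ → 𝒜) = concat α y <;> simp [h]

/-- Multiplication by the characteristic function of a subset of `X`. -/
noncomputable def restriction (A : Set X) : Module.End R (X → R) where
  toFun f := A.indicator f
  map_add' f g := Set.indicator_add A f g
  map_smul' r f := Set.indicator_const_smul A r f

variable {R X}

theorem annihilation_apply (α : List 𝒜) (f : X → R) (x : X) :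
    annihilation R X α f x = extendZero R X f (concat α x) := rfl

theorem creation_apply_of_eq {α : List 𝒜} (f : X → R) {x : X} {y : ℕ → 𝒜}
    (h : (x : ℕ → 𝒜) = concat α y) : creation R X α f x = extendZero R X f y := by
  refine (if_pos ⟨y, h⟩).trans (congrArg _ (funext fun n => ?_))
  rw [h, concat_apply_add]

theorem creation_apply_of_ne {α : List 𝒜} (f : X → R) {x : X}
    (h : ¬ ∃ y, (x : ℕ → 𝒜) = concat α y) : creation R X α f x = 0 := if_neg h

theorem restriction_apply (A : Set X) (f : X → R) : restriction R X A f = A.indicator f := rfl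

theorem annihilation_nil : annihilation R X [] = 1 := by
  ext1 f
  funext x
  rw [annihilation_apply, concat_nil, extendZero_of_mem R f x.2]
  rfl

theorem creation_nil : creation R X [] = 1 := by
  ext1 f
  funext x
  rw [creation_apply_of_eq f (concat_nil _).symm, extendZero_of_mem R f x.2]
  rfl

theorem annihilation_append (hX : IsSubshift X) (α β : List 𝒜) :
    annihilation R X (α ++ β) = annihilation R X β * annihilation R X α := by
  ext1 f
  funext x
  rw [Module.End.mul_apply, annihilation_apply, annihilation_apply, concat_append]
  by_cases h : concat β x ∈ X
  · rw [extendZero_of_mem _ _ h, annihilation_apply]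
  · rw [extendZero_of_notMem _ _ h, extendZero_of_notMem _ _ (mt hX.mem_of_concat_mem h)]

theorem creation_append (hX : IsSubshift X) (α β : List 𝒜) :
    creation R X (α ++ β) = creation R X α * creation R X β := by
  ext1 f
  funext x
  rw [Module.End.mul_apply]
  by_cases hα : ∃ y, (x : ℕ → 𝒜) = concat α y
  · obtain ⟨y, hy⟩ := hα
    have hyX : y ∈ X := hX.mem_of_concat_mem (hy ▸ x.2)
    rw [creation_apply_of_eq _ hy, extendZero_of_mem _ _ hyX]
    by_cases hβ : ∃ z, y = concat β z
    · obtain ⟨z, hz⟩ := hβ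
      rw [creation_apply_of_eq f (show (⟨y, hyX⟩ : X).1 = concat β z from hz),
        creation_apply_of_eq f (by rw [hy, hz, concat_append])]
    · rw [creation_apply_of_ne f (x := ⟨y, hyX⟩) hβ, creation_apply_of_ne]
      rintro ⟨z, hz⟩
      -- Cancel the prefix `α` in `α y = α β z`.
      refine hβ ⟨z, funext fun n => ?_⟩
      rw [← concat_apply_add α y, ← hy, hz, concat_append, concat_apply_add]
  · rw [creation_apply_of_ne _ hα, creation_apply_of_ne]
    rintro ⟨z, hz⟩
    exact hα ⟨_, hz.trans (concat_append _ _ _)⟩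

theorem creation_annihilation_apply (hX : IsSubshift X) (α : List 𝒜) (f : X → R) {x : X}
    {y : ℕ → 𝒜} (h : (x : ℕ → 𝒜) = concat α y) :
    creation R X α (annihilation R X α f) x = f x := by
  have hy : y ∈ X := hX.mem_of_concat_mem (h ▸ x.2)
  rw [creation_apply_of_eq _ h, extendZero_of_mem _ _ hy, annihilation_apply, ← h,
    extendZero_of_mem _ _ x.2]

theorem creation_annihilation_creation (hX : IsSubshift X) (α : List 𝒜) :
    creation R X α * annihilation R X α * creation R X α = creation R X α := by
  ext1 f
  funext x
  simp only [Module.End.mul_apply]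
  by_cases h : ∃ y, (x : ℕ → 𝒜) = concat α y
  · obtain ⟨y, hy⟩ := h
    rw [creation_annihilation_apply hX α _ hy]
  · rw [creation_apply_of_ne _ h, creation_apply_of_ne _ h]

theorem annihilation_creation_annihilation (hX : IsSubshift X) (α : List 𝒜) :
    annihilation R X α * creation R X α * annihilation R X α = annihilation R X α := by
  ext1 f
  funext x
  simp only [Module.End.mul_apply]
  rw [annihilation_apply, annihilation_apply]
  by_cases h : concat α x ∈ X
  · rw [extendZero_of_mem _ _ h, extendZero_of_mem _ _ h, creation_annihilation_apply hX α f rfl]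
  · rw [extendZero_of_notMem _ _ h, extendZero_of_notMem _ _ h]

/-- At `x = β y` the evaluation point runs through `y`, `α y`, `y` and back to `β y`; the value
survives exactly when `α y ∈ X`. -/
theorem creation_annihilation_eq_restriction (hX : IsSubshift X) (α β : List 𝒜) :
    creation R X β * annihilation R X α * creation R X α * annihilation R X β =
      restriction R X (C X α β) := by
  ext1 f
  funext x
  simp only [Module.End.mul_apply, restriction_apply]
  by_cases hβ : ∃ y, (x : ℕ → 𝒜) = concat β y
  · obtain ⟨y, hy⟩ := hβ
    have hyX : y ∈ X := hX.mem_of_concat_mem (hy ▸ x.2)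
    rw [creation_apply_of_eq _ hy, extendZero_of_mem _ _ hyX, annihilation_apply]
    by_cases hα : concat α y ∈ X
    · rw [extendZero_of_mem _ _ hα, Set.indicator_of_mem (show x ∈ C X α β from ⟨y, hy, hα⟩),
        creation_apply_of_eq _ (x := ⟨_, hα⟩) rfl, extendZero_of_mem _ _ hyX, annihilation_apply,
        ← hy, extendZero_of_mem _ _ x.2]
    · rw [extendZero_of_notMem _ _ hα, Set.indicator_of_notMem]
      rintro ⟨z, hz, hzX⟩
      have : y = z := funext fun n => by
        rw [← concat_apply_add β y, ← hy, hz, concat_apply_add]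
      exact hα (this ▸ hzX)
  · rw [creation_apply_of_ne _ hβ, Set.indicator_of_notMem]
    rintro ⟨z, hz, -⟩
    exact hβ ⟨z, hz⟩

theorem isProjectionFamily_restriction :
    IsProjectionFamily fun A : U X => restriction R X (A : Set X) where
  map_top := by
    ext1 f
    exact Set.indicator_univ f
  map_bot := by
    ext1 f
    exact Set.indicator_empty f
  map_inf A B := by
    ext1 f
    exact (Set.indicator_indicator (A : Set X) B f).symm
  map_sup A B := by
    rw [eq_sub_iff_add_eq]
    ext1 f
    exact Set.indicator_union_add_inter f (A : Set X) B

variable (R X) in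
/-- The action of the generators on functions on `X`. -/
noncomputable def genAction : Gen X → Module.End R (X → R)
  | .p A => restriction R X A
  | .s a => creation R X [a]
  | .sStar a => annihilation R X [a]

theorem lift_genAction_fp (A : U X) :
    FreeAlgebra.lift R (genAction R X) (fp R X A) = restriction R X A :=
  FreeAlgebra.lift_ι_apply _ _

theorem lift_genAction_fs (hX : IsSubshift X) (α : List 𝒜) :
    FreeAlgebra.lift R (genAction R X) (fs R X α) = creation R X α := by
  induction α with
  | nil => rw [creation_nil, fs, List.map_nil, List.prod_nil, map_one]
  | cons a α ih =>
    rw [← List.singleton_append, creation_append hX, ← ih, fs, fs, List.map_append,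
      List.prod_append, map_mul]
    simp [genAction]

theorem lift_genAction_fsStar (hX : IsSubshift X) (α : List 𝒜) :
    FreeAlgebra.lift R (genAction R X) (fsStar R X α) = annihilation R X α := by
  induction α with
  | nil => rw [annihilation_nil, fsStar, List.reverse_nil, List.map_nil, List.prod_nil, map_one]
  | cons a α ih =>
    rw [← List.singleton_append, annihilation_append hX, ← ih, fsStar, fsStar,
      List.reverse_append, List.map_append, List.prod_append, map_mul]
    simp [genAction]

variable (R) in
/-- The representation of the unital subshift algebra on functions on `X`. -/
noncomputable def representation (hX : IsSubshift X) :
    UnitalSubshiftAlgebra R X →ₐ[R] Module.End R (X → R) :=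
  RingQuot.liftAlgHom R ⟨FreeAlgebra.lift R (genAction R X), by
    have h := isProjectionFamily_restriction (R := R) (X := X)
    intro a b hab
    cases hab with
    | p_top => rw [lift_genAction_fp, map_one]; exact h.map_top
    | p_inter A B => simp only [map_mul, lift_genAction_fp]; exact h.map_inf A B
    | p_union A B => simp only [map_add, map_sub, lift_genAction_fp]; exact h.map_sup A B
    | p_empty => rw [lift_genAction_fp, map_zero]; exact h.map_bot
    | s_sStar_s a =>
      simp only [map_mul, lift_genAction_fs hX, lift_genAction_fsStar hX]
      exact creation_annihilation_creation hX [a]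
    | sStar_s_sStar a =>
      simp only [map_mul, lift_genAction_fs hX, lift_genAction_fsStar hX]
      exact annihilation_creation_annihilation hX [a]
    | p_C α β hα hβ =>
      simp only [map_mul, lift_genAction_fs hX, lift_genAction_fsStar hX, lift_genAction_fp]
      exact creation_annihilation_eq_restriction hX α β⟩

theorem representation_p (hX : IsSubshift X) (A : U X) :
    representation R hX (p R X A) = restriction R X A := by
  rw [representation, p, RingQuot.liftAlgHom_mkAlgHom_apply, lift_genAction_fp]

theorem U_eq_bot_or_nonempty (A : U X) : A = ⊥ ∨ (A : Set X).Nonempty := by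
  rcases (A : Set X).eq_empty_or_nonempty with h | h
  exacts [.inl (Subtype.ext h), .inr h]

/-- Represent `r • p_A`, apply it to the constant function `1`, and evaluate at a point of `A`: the
result is `r`. -/
theorem smul_p_eq_zero (hX : IsSubshift X) (r : R) (A : U X) (h : r • p R X A = 0) :
    r = 0 ∨ A = ⊥ := by
  rcases U_eq_bot_or_nonempty A with hA | ⟨x, hx⟩
  · exact .inr hA
  · have h1 := congrArg (fun T => representation R hX T 1 x) h
    simp only [map_smul, representation_p, map_zero] at h1
    refine .inl ?_
    simpa [restriction_apply, hx] using h1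

/-- The ultrafilter of all members of `𝒰` containing a given point. -/
theorem exists_pointUltrafilter (x : X) :
    ∃ ξ : StoneDual (U X), ∀ A, A ∈ ξ.1 ↔ x ∈ (A : Set X) :=
  StoneDual.exists_of_prime {A : U X | x ∈ (A : Set X)} trivial (fun _ ha _ hb => ⟨ha, hb⟩)
    (fun _ _ hab ha => hab ha) fun _ => Iff.rfl

theorem smul_basicIndicator_eq_zero (r : R) (A : U X) (h : r • basicIndicator R A = 0) :
    r = 0 ∨ A = ⊥ := by
  rcases U_eq_bot_or_nonempty A with hA | ⟨x, hx⟩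
  · exact .inr hA
  · obtain ⟨ξ, hξ⟩ := exists_pointUltrafilter x
    have h1 := congrFun h ξ
    refine .inl ?_
    simpa [basicIndicator, (hξ A).2 hx] using h1

end Representation

/-! ### The diagonal subalgebra -/

section Diagonal

variable {𝒜 : Type*} {R : Type*} [CommRing R] {X : Set (ℕ → 𝒜)}

variable (R X) in
theorem isProjectionFamily_p : IsProjectionFamily (p R X) where
  map_top := by
    rw [p, RingQuot.mkAlgHom_rel R (Rel.p_top (R := R) (X := X)), map_one]
  map_bot := by
    rw [p, RingQuot.mkAlgHom_rel R (Rel.p_empty (R := R) (X := X)), map_zero]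
  map_inf A B := by
    rw [p, RingQuot.mkAlgHom_rel R (Rel.p_inter A B), map_mul]
    rfl
  map_sup A B := by
    rw [p, RingQuot.mkAlgHom_rel R (Rel.p_union A B), map_sub, map_add]
    rfl

@[simp] theorem s_nil : s R X [] = 1 := by simp [s, fs]

@[simp] theorem sStar_nil : sStar R X [] = 1 := by simp [sStar, fsStar]

theorem s_append (α β : List 𝒜) : s R X (α ++ β) = s R X α * s R X β := by
  simp only [s, fs, List.map_append, List.prod_append, map_mul]

theorem sStar_append (α β : List 𝒜) : sStar R X (α ++ β) = sStar R X β * sStar R X α := by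
  simp only [sStar, fsStar, List.reverse_append, List.map_append, List.prod_append, map_mul]

theorem s_singleton_mul_sStar_mul_s (a : 𝒜) :
    s R X [a] * sStar R X [a] * s R X [a] = s R X [a] := by
  simp only [s, sStar, ← map_mul]
  exact RingQuot.mkAlgHom_rel R (Rel.s_sStar_s a)

theorem s_mul_sStar_mul_s_mul_sStar {α β : List 𝒜} (hα : α ∈ language X) (hβ : β ∈ language X) :
    s R X β * sStar R X α * s R X α * sStar R X β = p R X (CU X hα hβ) := by
  simp only [s, sStar, ← map_mul]
  exact RingQuot.mkAlgHom_rel R (Rel.p_C α β hα hβ)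

/-- Relation (iii) with `β` empty; the empty word is in the language as a prefix of `α`. -/
theorem sStar_mul_s {α : List 𝒜} (hα : α ∈ language X) :
    sStar R X α * s R X α = p R X (CU X hα (mem_language_of_append_left (α := []) hα)) := by
  simpa using s_mul_sStar_mul_s_mul_sStar (R := R) hα (mem_language_of_append_left (α := []) hα)

theorem s_mul_sStar {α : List 𝒜} (hα : α ∈ language X) :
    s R X α * sStar R X α = p R X (CU X (mem_language_of_append_left (α := []) hα) hα) := by
  simpa using s_mul_sStar_mul_s_mul_sStar (R := R) (mem_language_of_append_left (α := []) hα) hα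

/-- Relation (ii) covers single letters only. For `aα` the middle factors `s_α s_α^*` and `s_a^*
s_a` are both of the form `p_A`, so they commute and induction applies. -/
theorem s_mul_sStar_mul_s (hX : IsSubshift X) {α : List 𝒜} (hα : α ∈ language X) :
    s R X α * sStar R X α * s R X α = s R X α := by
  induction α with
  | nil => simp
  | cons a α ih =>
    rw [← List.singleton_append] at hα ⊢
    have ha := mem_language_of_append_left hα
    have hα' := hX.mem_language_of_append_right hα
    rw [s_append, sStar_append]
    calc s R X [a] * s R X α * (sStar R X α * sStar R X [a]) * (s R X [a] * s R X α)
        = s R X [a] * ((s R X α * sStar R X α) * (sStar R X [a] * s R X [a])) * s R X α := by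
          simp only [mul_assoc]
      _ = s R X [a] * ((sStar R X [a] * s R X [a]) * (s R X α * sStar R X α)) * s R X α := by
          rw [s_mul_sStar hα', sStar_mul_s ha, (isProjectionFamily_p R X).commute]
      _ = s R X [a] * sStar R X [a] * s R X [a] * (s R X α * sStar R X α * s R X α) := by
          simp only [mul_assoc]
      _ = s R X [a] * s R X α := by rw [s_singleton_mul_sStar_mul_s, ih hα']

/-- Between `s_α` and `s_γ` one can insert `p` of `C(α, ω) ∩ C(ω, γ)`, which is empty. -/
theorem s_mul_s_eq_zero (hX : IsSubshift X) {α γ : List 𝒜} (hα : α ∈ language X)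
    (hγ : γ ∈ language X) (h : α ++ γ ∉ language X) : s R X α * s R X γ = 0 := by
  rw [← s_mul_sStar_mul_s hX hα, ← s_mul_sStar_mul_s hX hγ]
  calc s R X α * sStar R X α * s R X α * (s R X γ * sStar R X γ * s R X γ)
      = s R X α * ((sStar R X α * s R X α) * (s R X γ * sStar R X γ)) * s R X γ := by
        simp only [mul_assoc]
    _ = 0 := by
        rw [s_mul_sStar hγ, sStar_mul_s hα, ← (isProjectionFamily_p R X).map_inf]
        have : CU X hα (mem_language_of_append_left (α := []) hα) ⊓
            CU X (mem_language_of_append_left (α := []) hγ) hγ = ⊥ :=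
          Subtype.ext (C_nil_right_inter_C_nil_left h)
        rw [this, (isProjectionFamily_p R X).map_bot, mul_zero, zero_mul]

theorem p_mem_projectionSpan (A : U X) : p R X A ∈ projectionSpan R X :=
  Submodule.subset_span ⟨A, rfl⟩

theorem toSubmodule_range_lift_p :
    Subalgebra.toSubmodule ((isProjectionFamily_p R X).lift R).range = projectionSpan R X :=
  (isProjectionFamily_p R X).toSubmodule_range_lift

theorem mul_mem_projectionSpan {x y : UnitalSubshiftAlgebra R X} (hx : x ∈ projectionSpan R X)
    (hy : y ∈ projectionSpan R X) : x * y ∈ projectionSpan R X := by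
  rw [← toSubmodule_range_lift_p, Subalgebra.mem_toSubmodule] at *
  exact mul_mem hx hy

/-- Conjugation by `s_α` is multiplicative here because `s_α^* s_α` is some `p_C`, commutes with
`p_A`, and is absorbed by `s_α`. -/
theorem s_mul_p_inf_mul_sStar (hX : IsSubshift X) {α : List 𝒜} (hα : α ∈ language X)
    (A B : U X) : s R X α * p R X (A ⊓ B) * sStar R X α =
      s R X α * p R X A * sStar R X α * (s R X α * p R X B * sStar R X α) := by
  have hp := isProjectionFamily_p R X
  calc s R X α * p R X (A ⊓ B) * sStar R X α
      = s R X α * (sStar R X α * s R X α * p R X A) * p R X B * sStar R X α := by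
        rw [hp.map_inf]
        conv_lhs => rw [← s_mul_sStar_mul_s hX hα]
        simp only [mul_assoc]
    _ = s R X α * (p R X A * (sStar R X α * s R X α)) * p R X B * sStar R X α := by
        rw [sStar_mul_s hα, hp.commute A]
    _ = _ := by simp only [mul_assoc]

/-- For a generator `C(β, γ)` the conjugate is `p` of `C(β, αγ)`, or zero if `αγ` is not in the
language. Complements use that `s_α s_α^*` is itself a projection `p_C`; unions use multiplicativity
of conjugation. -/
theorem s_mul_p_mul_sStar_mem (hX : IsSubshift X) {α : List 𝒜} (hα : α ∈ language X)
    (A : U X) : s R X α * p R X A * sStar R X α ∈ projectionSpan R X := by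
  have hp := isProjectionFamily_p R X
  obtain ⟨A, hA⟩ := A
  induction hA using BooleanSubalgebra.closure_bot_sup_induction with
  | mem A hA =>
    obtain ⟨β, hβ, γ, hγ, rfl⟩ := hA
    change s R X α * p R X (CU X hβ hγ) * sStar R X α ∈ _
    have key : s R X α * p R X (CU X hβ hγ) * sStar R X α =
        s R X (α ++ γ) * sStar R X β * s R X β * sStar R X (α ++ γ) := by
      rw [← s_mul_sStar_mul_s_mul_sStar hβ hγ, s_append, sStar_append]
      simp only [mul_assoc]
    rw [key]
    by_cases h : α ++ γ ∈ language X
    · rw [s_mul_sStar_mul_s_mul_sStar hβ h]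
      exact p_mem_projectionSpan _
    · rw [s_append, s_mul_s_eq_zero hX hα hγ h, zero_mul, zero_mul, zero_mul]
      exact zero_mem _
  | bot =>
    change s R X α * p R X ⊥ * sStar R X α ∈ _
    rw [hp.map_bot, mul_zero, zero_mul]
    exact zero_mem _
  | sup A hA B hB ihA ihB =>
    change s R X α * p R X (⟨A, hA⟩ ⊔ ⟨B, hB⟩) * sStar R X α ∈ _
    rw [hp.map_sup, mul_sub, mul_add, sub_mul, add_mul, s_mul_p_inf_mul_sStar hX hα]
    exact sub_mem (add_mem ihA ihB) (mul_mem_projectionSpan ihA ihB)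
  | compl A hA ih =>
    change s R X α * p R X (⟨A, hA⟩ : U X)ᶜ * sStar R X α ∈ _
    rw [hp.map_compl, mul_sub, mul_one, sub_mul, s_mul_sStar hα]
    exact sub_mem (p_mem_projectionSpan _) ih

theorem diagonalSpan_eq_projectionSpan (hX : IsSubshift X) :
    diagonalSpan R X = projectionSpan R X := by
  apply le_antisymm
  · rw [diagonalSpan, Submodule.span_le]
    rintro _ ⟨A, α, hα, rfl⟩
    exact s_mul_p_mul_sStar_mem hX hα A
  · rw [projectionSpan, Submodule.span_le]
    rintro _ ⟨A, rfl⟩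
    -- The empty word is in the language only if `X` has a point; the case `A = ⊥` also absorbs
    -- empty `X`.
    rcases U_eq_bot_or_nonempty A with rfl | ⟨x, -⟩
    · rw [(isProjectionFamily_p R X).map_bot]
      exact zero_mem _
    · exact Submodule.subset_span ⟨A, [], nil_mem_language ⟨x, x.2⟩, by simp⟩

end Diagonal

end SubshiftAlg

theorem mainTheorem8 {𝒜 : Type*} [Nonempty 𝒜] {R : Type*} [CommRing R]
    (hR : ∀ e : R, IsIdempotentElem e → e = 0 ∨ e = 1)
    (X : Set (ℕ → 𝒜)) (hX : SubshiftAlg.IsSubshift X) :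
    SubshiftAlg.diagonalSpan R X = SubshiftAlg.projectionSpan R X ∧
    ∃ D : Subalgebra R (SubshiftAlg.UnitalSubshiftAlgebra R X),
      Subalgebra.toSubmodule D = SubshiftAlg.diagonalSpan R X ∧
      ∃ φ : D →ₙₐ[R] SubshiftAlg.Lc (SubshiftAlg.StoneDual (SubshiftAlg.U X)) R,
        Function.Bijective φ := by
  have hdiag := SubshiftAlg.diagonalSpan_eq_projectionSpan (R := R) hX
  obtain ⟨φ, hφ, hrange⟩ := (SubshiftAlg.isProjectionFamily_p R X).exists_algHom_range_lift
    (SubshiftAlg.isProjectionFamily_basicIndicator (SubshiftAlg.U X) R)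
    (SubshiftAlg.smul_p_eq_zero hX) SubshiftAlg.smul_basicIndicator_eq_zero
  rw [SubshiftAlg.coe_range_lift_basicIndicator] at hrange
  -- `D` is the image of the formal combinations under the extension of `p`; `hrange` makes the
  -- corestriction of `φ` to `Lc` both well defined and onto.
  refine ⟨hdiag, _, SubshiftAlg.toSubmodule_range_lift_p.trans hdiag.symm,
    NonUnitalAlgHom.codRestrict (φ : _ →ₙₐ[R] _) _ fun x => ?_, fun x y h => ?_, fun f => ?_⟩
  · rw [← SetLike.mem_coe, ← hrange]
    exact ⟨x, rfl⟩
  · exact hφ (congrArg Subtype.val h)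
  · obtain ⟨x, hx⟩ := hrange.symm.subset f.2
    exact ⟨x, Subtype.ext hx⟩
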